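/- **Setting.** Let $N\ge 2$, let $\Omega\subset\mathbb R^N$ be a nonempty bounded open set (for instance a bounded regular domain), let $m\in\mathbb N$, and let $2^*=2N/(N-2)$ if $N\ge 3$, $2^*=+\infty$ if $N=2$. Let $f,g:\mathbb R\to\mathbb R$ be odd functions of class $C^1$ such that $f'(t),g'(t)\ge 0$ for $t>0$; there are $C>0$, $1<p<\min\{2^*/2,3\}$ and $1<q<\min\{2^*,3\}$ with $|f(t)|\le C(1+|t|^{p-1})$ and $|g(t)|\le C(1+|t|^{q-1})$ for all $t\in\mathbb R$; and $f(s)t+f(t)s\le f(s)s+f(t)t$, $g(s)t+g(t)s\le g(s)s+g(t)t$ for all $s,t\ge 0$. Put $F(s)=\int_0^s f$, $G(s)=\int_0^s g$, and for $u=(u_1,\dots,u_m)\in H^1_0(\Omega;\mathbb R^m)$ $$J(u)=\sum_{i=1}^m\int_\Omega\bigl(|\nabla u_i|^2+2G(u_i)\bigr)\,dx+\sum_{i,j=1,\ j\ne i}^m\int_\Omega F(u_i)F(u_j)\,dx .$$ Let $\mathcal M=\{u\in H^1_0(\Omega;\mathbb R^m):\|u_i\|_{L^2(\Omega)}=1\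 \forall i\}$ and $\sigma_i(u)=(u_1,\dots,-u_i,\dots,u_m)$. For integers $k_1,\dots,k_m\ge 2$, let $\Gamma^{(k_1,\dots,k_m)}$ be the family of all closed sets $A\subseteq\mathcal M$ with $\sigma_i(A)\subseteq A$ for all $i$ and with the following property: whenever $h_i:A\to\mathbb R^{k_i-1}$ ($i=1,\dots,m$) are continuous maps with $h_i\circ\sigma_i=-h_i$ and $h_i\circ\sigma_j=h_i$ for all $j\neq i$, there is $\bar u\in A$ with $h_1(\bar u)=0,\dots,h_m(\bar u)=0$. Let $\mathcal P$ be the set of all $u\in H^1_0(\Omega;\mathbb R^m)$ such that $u_i\ge 0$ a.e. or $u_i\le 0$ a.e. for some $i$, let $\mathcal P_\delta$ be the set of all $u\in H^1_0(\Omega;\mathbb R^m)$ whose $L^2(\Omega;\mathbb R^m)$-distance to $\mathcal P$ is less than $\delta$, and for $0<\delta<\sqrt2/2$ define the sign-changing minimax level (an infimum and supremum in $[-\infty,+\infty]$) $$d_\delta^{k_1,\dots,k_m}=\inf_{A\in\Gamma^{(k_1,\dots,k_m)}}\ \sup_{A\setminus\mathcal P_\delta}J .$$ Finally let $\lambda_1(\Omega)\le\lambda_2(\Omega)\le\cdots$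 be the eigenvalues of $-\Delta$ in $H^1_0(\Omega)$, counted with multiplicity. **Lemma.** For all $k_1,\dots,k_m\ge 2$ and every $\delta\in(0,\sqrt2/2)$, $$d_\delta^{k_1,\dots,k_m}\ \ge\ \sum_{i=1}^m\lambda_{k_i-1}(\Omega).$$ Moreover $\lambda_k(\Omega)\to+\infty$ as $k\to\infty$, and consequently the levels are unbounded: for every $R\in\mathbb R$ there is $K\in\mathbb N$ such that $d_\delta^{k_1,\dots,k_m}\ge R$ for every $\delta\in(0,\sqrt2/2)$ and all $k_1,\dots,k_m\ge 2$ with $k_i\ge K$ for some $i$. -/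

import Mathlib

open MeasureTheory Filter Topology
open scoped ENNReal ContDiff

noncomputable section

namespace CompetingSystem

/-- The Euclidean space `ℝ^N`. -/
abbrev Eu (N : ℕ) : Type := EuclideanSpace ℝ (Fin N)

/-! ### The Sobolev space `H¹₀(Ω)` -/

/-- The Hilbert space `L²(Ω) × L²(Ω; ℝ^N)` with `‖(u, V)‖² = ∫_Ω |u|² + ∫_Ω |V|²`.
An element `u` of `H¹(Ω)` is represented by the pair `(u, ∇u)`, whose norm here is
the `H¹`-norm of `u`. -/
abbrev L2Pair {N : ℕ} (Ω : Set (Eu N)) : Type :=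
  WithLp 2 (Lp ℝ 2 (volume.restrict Ω) × Lp (Eu N) 2 (volume.restrict Ω))

/-- The pairs `(φ, ∇φ)` with `φ ∈ C_c^∞(Ω)`. -/
def testPairs {N : ℕ} (Ω : Set (Eu N)) : Submodule ℝ (L2Pair Ω) where
  carrier := {w | ∃ φ : Eu N → ℝ, ContDiff ℝ ∞ φ ∧ HasCompactSupport φ ∧ tsupport φ ⊆ Ω ∧
    w.fst =ᵐ[volume.restrict Ω] φ ∧ w.snd =ᵐ[volume.restrict Ω] gradient φ}
  zero_mem' := by
    refine ⟨0, contDiff_const, HasCompactSupport.zero, ?_, Lp.coeFn_zero _ _ _, ?_⟩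
    · simp [tsupport]
    · have h : gradient (0 : Eu N → ℝ) = 0 := by
        funext x
        simp [gradient]
      rw [h]
      exact Lp.coeFn_zero _ _ _
  add_mem' := by
    rintro a b ⟨φ, h1, h2, h3, h4, h5⟩ ⟨ψ, k1, k2, k3, k4, k5⟩
    refine ⟨φ + ψ, h1.add k1, h2.add k2,
      (tsupport_add φ ψ).trans (Set.union_subset h3 k3), ?_, ?_⟩
    · filter_upwards [Lp.coeFn_add a.fst b.fst, h4, k4] with x e1 e2 e3
      rw [WithLp.add_fst, e1, Pi.add_apply, Pi.add_apply, e2, e3]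
    · filter_upwards [Lp.coeFn_add a.snd b.snd, h5, k5] with x e1 e2 e3
      have d1 : DifferentiableAt ℝ φ x := h1.differentiable (by simp) x
      have d2 : DifferentiableAt ℝ ψ x := k1.differentiable (by simp) x
      rw [WithLp.add_snd, e1, Pi.add_apply, e2, e3]
      simp only [gradient]
      rw [fderiv_add d1 d2, map_add]
  smul_mem' := by
    rintro c a ⟨φ, h1, h2, h3, h4, h5⟩
    refine ⟨c • φ, contDiff_const.smul h1, h2.smul_left (f := fun _ => c),
      (closure_mono (Function.support_const_smul_subset c φ)).trans h3, ?_, ?_⟩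
    · filter_upwards [Lp.coeFn_smul c a.fst, h4] with x e1 e2
      rw [WithLp.smul_fst, e1, Pi.smul_apply, Pi.smul_apply, e2]
    · filter_upwards [Lp.coeFn_smul c a.snd, h5] with x e1 e2
      have d1 : DifferentiableAt ℝ φ x := h1.differentiable (by simp) x
      rw [WithLp.smul_snd, e1, Pi.smul_apply, e2]
      simp only [gradient]
      rw [fderiv_const_smul d1, map_smul]

/-- `H¹₀(Ω)`: the closure of `C_c^∞(Ω)` in the `H¹`-norm. Limits of pairs `(φ, ∇φ)` in
`L² × L²` are again of the form `(u, ∇u)` with `∇u` the weak gradient of `u`. -/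
def H10sub {N : ℕ} (Ω : Set (Eu N)) : Submodule ℝ (L2Pair Ω) :=
  (testPairs Ω).topologicalClosure

/-- The space `H¹₀(Ω)`, with the `H¹`-norm. -/
abbrev H10 {N : ℕ} (Ω : Set (Eu N)) : Type := ↥(H10sub Ω)

/-- The function `u ∈ L²(Ω)` underlying `u ∈ H¹₀(Ω)`. -/
def H10.fn {N : ℕ} {Ω : Set (Eu N)} (u : H10 Ω) : Lp ℝ 2 (volume.restrict Ω) :=
  (u : L2Pair Ω).fst

/-- The weak gradient `∇u ∈ L²(Ω; ℝ^N)` of `u ∈ H¹₀(Ω)`. -/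
def H10.grad {N : ℕ} {Ω : Set (Eu N)} (u : H10 Ω) : Lp (Eu N) 2 (volume.restrict Ω) :=
  (u : L2Pair Ω).snd

/-! ### Dirichlet eigenvalues -/

/-- The eigenspace `{u ∈ H¹₀(Ω) : -Δu = μ u weakly}`, that is
`∫_Ω ∇u · ∇v = μ ∫_Ω u v` for all `v ∈ H¹₀(Ω)`. -/
def eigenspace {N : ℕ} (Ω : Set (Eu N)) (μ : ℝ) : Submodule ℝ (H10 Ω) where
  carrier := {u | ∀ v : H10 Ω, inner ℝ u.grad v.grad = μ * inner ℝ u.fn v.fn}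
  zero_mem' := by
    intro v
    simp [H10.grad, H10.fn]
  add_mem' := by
    intro a b ha hb v
    have h1 := ha v
    have h2 := hb v
    simp only [H10.grad, H10.fn, Submodule.coe_add, WithLp.add_fst, WithLp.add_snd,
      inner_add_left] at *
    rw [h1, h2]
    ring
  smul_mem' := by
    intro c a ha v
    have h1 := ha v
    simp only [H10.grad, H10.fn, Submodule.coe_smul, WithLp.smul_fst, WithLp.smul_snd,
      real_inner_smul_left] at *
    rw [h1]
    ring

/-- `λ_k(Ω)`, `k = 1, 2, …`: the `k`-th eigenvalue of `(-Δ, H¹₀(Ω))`, in nondecreasing order and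
counted with multiplicity, i.e. the least `Λ` such that the eigenvalues `μ ≤ Λ` have total
multiplicity at least `k`. -/
def dirichletEigenvalue {N : ℕ} (Ω : Set (Eu N)) (k : ℕ) : ℝ :=
  sInf {Λ : ℝ | (k : Cardinal) ≤
    Module.rank ℝ (⨆ μ : Set.Iic Λ, eigenspace Ω (μ : ℝ) : Submodule ℝ (H10 Ω))}

/-! ### The nonlinearities -/

/-- The critical Sobolev exponent `2^* = 2N/(N-2)` if `N ≥ 3`, and `2^* = +∞` otherwise. -/
def sobolevExponent (N : ℕ) : EReal :=
  if 3 ≤ N then ((2 * N / (N - 2) : ℝ) : EReal) else ⊤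

/-- The standing assumptions on `f` and `g`: odd, of class `C¹`, nondecreasing on `(0, ∞)`,
with growth exponents `1 < p < min {2^*/2, 3}` and `1 < q < min {2^*, 3}`, and
`h(s)t + h(t)s ≤ h(s)s + h(t)t` for `s, t ≥ 0` and `h = f, g`. -/
structure Admissible (N : ℕ) (f g : ℝ → ℝ) : Prop where
  contDiff_f : ContDiff ℝ 1 f
  contDiff_g : ContDiff ℝ 1 g
  odd_f : ∀ t, f (-t) = -f t
  odd_g : ∀ t, g (-t) = -g t
  deriv_nonneg : ∀ t, 0 < t → 0 ≤ deriv f t ∧ 0 ≤ deriv g t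
  growth : ∃ C p q : ℝ, 0 < C ∧ 1 < p ∧ (p : EReal) < min (sobolevExponent N / 2) 3 ∧
    1 < q ∧ (q : EReal) < min (sobolevExponent N) 3 ∧
    ∀ t : ℝ, |f t| ≤ C * (1 + |t| ^ (p - 1)) ∧ |g t| ≤ C * (1 + |t| ^ (q - 1))
  rearr : ∀ s t : ℝ, 0 ≤ s → 0 ≤ t →
    f s * t + f t * s ≤ f s * s + f t * t ∧ g s * t + g t * s ≤ g s * s + g t * t

/-- `H(s) = ∫_0^s h(ξ) dξ`. -/
def primitive (h : ℝ → ℝ) (s : ℝ) : ℝ := ∫ ξ in (0 : ℝ)..s, h ξ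

/-- The functional `J(u) = ∑_i ∫_Ω (|∇u_i|² + 2 G(u_i)) + ∑_{i ≠ j} ∫_Ω F(u_i) F(u_j)`
on `H¹₀(Ω; ℝ^m)`. All the integrands are integrable when `f` and `g` are admissible and `Ω` is
bounded, by the Sobolev embedding. -/
def energy {N m : ℕ} (Ω : Set (Eu N)) (f g : ℝ → ℝ) (u : Fin m → H10 Ω) : ℝ :=
  ∑ i, ((∫ x in Ω, ‖(u i).grad x‖ ^ 2) + ∫ x in Ω, 2 * primitive g ((u i).fn x)) +
    ∑ i, ∑ j ∈ Finset.univ.filter (fun j => j ≠ i),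
      ∫ x in Ω, primitive f ((u i).fn x) * primitive f ((u j).fn x)

/-! ### Vector genus and minimax levels -/

/-- `𝓜 = {u ∈ H¹₀(Ω; ℝ^m) : ‖u_i‖_{L²(Ω)} = 1 for all i}`. -/
def sphereM {N : ℕ} (Ω : Set (Eu N)) (m : ℕ) : Set (Fin m → H10 Ω) :=
  {u | ∀ i, ‖(u i).fn‖ = 1}

/-- The involution `σ_i(u) = (u_1, …, -u_i, …, u_m)`. -/
def signFlip {N m : ℕ} {Ω : Set (Eu N)} (i : Fin m) (u : Fin m → H10 Ω) : Fin m → H10 Ω :=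
  Function.update u i (-u i)

/-- The class `𝓕` of closed subsets of `𝓜` that are invariant under every `σ_i`. -/
def symmetricSets {N : ℕ} (Ω : Set (Eu N)) (m : ℕ) : Set (Set (Fin m → H10 Ω)) :=
  {A | A ⊆ sphereM Ω m ∧ IsClosed A ∧ ∀ u ∈ A, ∀ i, signFlip i u ∈ A}

/-- The class `F_{(k_1, …, k_m)}(A)`: continuous maps `h = (h_1, …, h_m)` on `A`, with
`h_i : A → ℝ^{k_i - 1}`, `h_i ∘ σ_i = -h_i`, and `h_i ∘ σ_j = h_i` for `j ≠ i`. (The values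
outside `A` are irrelevant.) -/
def IsEquivariantFamily {N m : ℕ} {Ω : Set (Eu N)} (k : Fin m → ℕ) (A : Set (Fin m → H10 Ω))
    (h : (i : Fin m) → (Fin m → H10 Ω) → EuclideanSpace ℝ (Fin (k i - 1))) : Prop :=
  ∀ i, ContinuousOn (h i) A ∧ ∀ u ∈ A,
    h i (signFlip i u) = -h i u ∧ ∀ j, j ≠ i → h i (signFlip j u) = h i u

/-- `Γ^{(k_1, …, k_m)}`: the sets `A ∈ 𝓕` of vector genus at least `(k_1, …, k_m)`, i.e. such that
every `h ∈ F_{(k_1, …, k_m)}(A)` has a common zero in `A`. -/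
def genusClass {N m : ℕ} (Ω : Set (Eu N)) (k : Fin m → ℕ) : Set (Set (Fin m → H10 Ω)) :=
  {A | A ∈ symmetricSets Ω m ∧
    ∀ h : (i : Fin m) → (Fin m → H10 Ω) → EuclideanSpace ℝ (Fin (k i - 1)),
      IsEquivariantFamily k A h → ∃ u ∈ A, ∀ i, h i u = 0}

/-- `𝓟 = ⋃_i (𝓟_i ∪ -𝓟_i)`, where `𝓟_i = {u ∈ H¹₀(Ω; ℝ^m) : u_i ≥ 0 a.e.}`. -/
def cone {N : ℕ} (Ω : Set (Eu N)) (m : ℕ) : Set (Fin m → H10 Ω) :=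
  {u | ∃ i, 0 ≤ (u i).fn ∨ (u i).fn ≤ 0}

/-- The distance of `L²(Ω; ℝ^m)`. -/
def dist2 {N m : ℕ} {Ω : Set (Eu N)} (u v : Fin m → H10 Ω) : ℝ :=
  Real.sqrt (∑ i, ‖(u i).fn - (v i).fn‖ ^ 2)

/-- `𝓟_δ = {u ∈ H¹₀(Ω; ℝ^m) : dist₂(u, 𝓟) < δ}`. -/
def coneNhd {N : ℕ} (Ω : Set (Eu N)) (m : ℕ) (δ : ℝ) : Set (Fin m → H10 Ω) :=
  {u | ∃ v ∈ cone Ω m, dist2 u v < δ}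

/-- The minimax level `d_δ^{k_1, …, k_m} = inf_{A ∈ Γ^{(k_1, …, k_m)}} sup_{A \ 𝓟_δ} J`, an infimum
of suprema in the extended reals. -/
def minimaxLevel {N m : ℕ} (Ω : Set (Eu N)) (f g : ℝ → ℝ) (δ : ℝ) (k : Fin m → ℕ) : EReal :=
  ⨅ A ∈ genusClass Ω k, ⨆ u ∈ A \ coneNhd Ω m δ, (energy Ω f g u : EReal)

end CompetingSystem

end

namespace CompetingSystem

/-! Every `A` in the genus class is tested with one well-chosen equivariant family. Its component
`h_i`, a function of `u_i` alone, has first coordinate `‖u_i⁺‖ - ‖u_i⁻‖`; the remaining `k_i - 2`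
coordinates are `H¹` inner products of `u_i` with fixed vectors. All are odd and continuous, so they
vanish together at some `u ∈ A`. The first coordinates give `‖u_i⁺‖² = ‖u_i⁻‖² = 1/2`, which keeps
`u` at `L²`-distance at least `√2/2 > δ` from the cone (`notMem_coneNhd`). If the fixed vectors span
the eigenvectors with eigenvalue at most `Λ_i < λ_{k_i - 1}`, of which at most `k_i - 2` are
independent, then `‖∇u_i‖² ≥ Λ_i` (`exists_constraints`). As `F, G ≥ 0`, `J(u) ≥ ∑ ‖∇u_i‖² ≥ ∑ Λ_i`;
now let `Λ_i` increase to the eigenvalue.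

The spectral input is proved for the embedding `ι : H¹₀ → L²`. It is compact
(`isCompactOperator_embedL2`): averaging over cubes of side `h` costs `O(h)` in `L²`, and a bounded
set meets finitely many cubes. The compact operator `ι* ι` has eigenvalue `1 / (1 + μ)` where `-Δ`
has `μ`. This yields the Rayleigh bound off the low eigenspaces, finite multiplicities, and, since
`ι` has infinite rank, `λ_k → ∞`. -/

theorem sq_lintegral_le {α : Type*} [MeasurableSpace α] (μ : Measure α) {f : α → ℝ≥0∞}
    (hf : AEMeasurable f μ) : (∫⁻ x, f x ∂μ) ^ 2 ≤ μ Set.univ * ∫⁻ x, f x ^ 2 ∂μ := by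
  have h := ENNReal.lintegral_mul_le_Lp_mul_Lq μ Real.HolderConjugate.two_two hf
    (aemeasurable_const (b := (1 : ℝ≥0∞)))
  have h2 : ∀ a : ℝ≥0∞, (a ^ (1 / 2 : ℝ)) ^ 2 = a := fun a => by
    rw [← ENNReal.rpow_natCast, ← ENNReal.rpow_mul]
    norm_num
  calc (∫⁻ x, f x ∂μ) ^ 2
      ≤ ((∫⁻ x, f x ^ (2 : ℝ) ∂μ) ^ (1 / 2 : ℝ) * (μ Set.univ) ^ (1 / 2 : ℝ)) ^ 2 := by
        gcongr
        simpa using h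
    _ = μ Set.univ * ∫⁻ x, f x ^ 2 ∂μ := by
        rw [mul_pow, h2, h2, mul_comm]
        simp only [ENNReal.rpow_two]

/-! ### Translation estimate in `L²`. -/

section Translation

variable {E : Type*} [NormedAddCommGroup E] [NormedSpace ℝ E]

/-- Fundamental theorem of calculus along the segment from `x` to `x + z`, then Cauchy–Schwarz on an
interval of length one. -/
theorem enorm_sub_sq_le {φ : E → ℝ} (hφ : ContDiff ℝ 1 φ) (x z : E) :
    ‖φ (x + z) - φ x‖ₑ ^ 2 ≤
      ‖z‖ₑ ^ 2 * ∫⁻ t in Set.Ioc (0 : ℝ) 1, ‖fderiv ℝ φ (x + t • z)‖ₑ ^ 2 := by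
  have hcd : Continuous (fderiv ℝ φ) := hφ.continuous_fderiv one_ne_zero
  have hc : Continuous fun t : ℝ => fderiv ℝ φ (x + t • z) := by fun_prop
  have hderiv : ∀ t : ℝ, HasDerivAt (fun t : ℝ => φ (x + t • z)) (fderiv ℝ φ (x + t • z) z) t := by
    intro t
    have h1 : HasDerivAt (fun t : ℝ => x + t • z) z t := by
      simpa using ((hasDerivAt_id t).smul_const z).const_add x
    exact ((hφ.differentiable one_ne_zero _).hasFDerivAt).comp_hasDerivAt t h1
  have hint := intervalIntegral.integral_eq_sub_of_hasDerivAt (a := 0) (b := 1)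
    (fun t _ => hderiv t) ((hc.clm_apply continuous_const).intervalIntegrable _ _)
  simp only [one_smul, zero_smul, add_zero] at hint
  rw [← hint, intervalIntegral.integral_of_le zero_le_one]
  have hm : Measurable fun t : ℝ => ‖fderiv ℝ φ (x + t • z)‖ₑ := hc.enorm.measurable
  calc _ ≤ (∫⁻ t in Set.Ioc (0 : ℝ) 1, ‖fderiv ℝ φ (x + t • z)‖ₑ * ‖z‖ₑ) ^ 2 := by
        gcongr
        refine (enorm_integral_le_lintegral_enorm _).trans (lintegral_mono fun t => ?_)
        exact ContinuousLinearMap.le_opENorm _ _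
    _ = ‖z‖ₑ ^ 2 * (∫⁻ t in Set.Ioc (0 : ℝ) 1, ‖fderiv ℝ φ (x + t • z)‖ₑ) ^ 2 := by
        rw [lintegral_mul_const _ hm, mul_pow, mul_comm]
    _ ≤ _ := by
        gcongr
        refine (sq_lintegral_le _ hm.aemeasurable).trans ?_
        simp

variable [MeasurableSpace E] [BorelSpace E] {μ : Measure E} [SFinite μ]
  [μ.IsAddRightInvariant]

/-- The `L²`-modulus of continuity of a `C¹` function is controlled by the derivative. -/
theorem lintegral_enorm_sub_sq_le {φ : E → ℝ} (hφ : ContDiff ℝ 1 φ) (z : E) :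
    ∫⁻ x, ‖φ (x + z) - φ x‖ₑ ^ 2 ∂μ ≤ ‖z‖ₑ ^ 2 * ∫⁻ x, ‖fderiv ℝ φ x‖ₑ ^ 2 ∂μ := by
  have hcd : Continuous (fderiv ℝ φ) := hφ.continuous_fderiv one_ne_zero
  have hm : Measurable fun p : E × ℝ => ‖fderiv ℝ φ (p.1 + p.2 • z)‖ₑ ^ 2 := by
    have : Continuous fun p : E × ℝ => fderiv ℝ φ (p.1 + p.2 • z) := by fun_prop
    exact (this.enorm.measurable).pow_const 2
  calc _ ≤ ∫⁻ x, (‖z‖ₑ ^ 2 * ∫⁻ t in Set.Ioc (0 : ℝ) 1, ‖fderiv ℝ φ (x + t • z)‖ₑ ^ 2) ∂μ :=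
        lintegral_mono fun x => enorm_sub_sq_le hφ x z
    _ = ‖z‖ₑ ^ 2 * ∫⁻ t in Set.Ioc (0 : ℝ) 1, (∫⁻ x, ‖fderiv ℝ φ (x + t • z)‖ₑ ^ 2 ∂μ) := by
        rw [lintegral_const_mul' _ _ (by simp), lintegral_lintegral_swap hm.aemeasurable]
    _ = _ := by
        have : ∀ t : ℝ, ∫⁻ x, ‖fderiv ℝ φ (x + t • z)‖ₑ ^ 2 ∂μ = ∫⁻ x, ‖fderiv ℝ φ x‖ₑ ^ 2 ∂μ :=
          fun t => lintegral_add_right_eq_self (fun x => ‖fderiv ℝ φ x‖ₑ ^ 2) (t • z)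
        simp only [this]
        simp

end Translation

/-! ### Approximation by averages over cubes. -/

section Cells

variable {N : ℕ}

/-- The index of the cube of side `h` containing `x`. -/
noncomputable def cellIndex (h : ℝ) (x : Eu N) : Fin N → ℤ := fun i => ⌊x i / h⌋

theorem measurable_cellIndex (h : ℝ) : Measurable (cellIndex h : Eu N → Fin N → ℤ) := by
  refine measurable_pi_lambda _ fun i => Measurable.floor ?_
  have : Continuous fun x : Eu N => x i := by fun_prop
  exact this.measurable.div_const h

theorem cellIndex_eq_iff {h : ℝ} (hh : 0 < h) (x : Eu N) (n : Fin N → ℤ) :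
    cellIndex h x = n ↔ ∀ i, x i ∈ Set.Ico (n i * h) (n i * h + h) := by
  simp only [funext_iff, cellIndex, Int.floor_eq_iff, Set.mem_Ico]
  refine forall_congr' fun i => ?_
  rw [le_div_iff₀ hh, div_lt_iff₀ hh]
  constructor <;> rintro ⟨h1, h2⟩ <;> exact ⟨h1, by linarith⟩

theorem volume_box (a : Fin N → ℝ) (l : ℝ) :
    volume {x : Eu N | ∀ i, x i ∈ Set.Ico (a i) (a i + l)} = ENNReal.ofReal l ^ N := by
  have h1 : {x : Eu N | ∀ i, x i ∈ Set.Ico (a i) (a i + l)} =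
      (WithLp.ofLp : Eu N → Fin N → ℝ) ⁻¹' Set.univ.pi fun i => Set.Ico (a i) (a i + l) := by
    ext x
    simp [Set.mem_pi]
  rw [h1, (PiLp.volume_preserving_ofLp (Fin N)).measure_preimage
    (MeasurableSet.univ_pi fun _ => measurableSet_Ico).nullMeasurableSet, Real.volume_pi_Ico]
  simp

theorem measurableSet_box (a : Fin N → ℝ) (l : ℝ) :
    MeasurableSet {x : Eu N | ∀ i, x i ∈ Set.Ico (a i) (a i + l)} := by
  have : {x : Eu N | ∀ i, x i ∈ Set.Ico (a i) (a i + l)} =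
      ⋂ i, (fun x : Eu N => x i) ⁻¹' Set.Ico (a i) (a i + l) := by
    ext x; simp
  rw [this]
  refine MeasurableSet.iInter fun i => ?_
  have : Continuous fun x : Eu N => x i := by fun_prop
  exact this.measurable measurableSet_Ico

theorem norm_sq_le_of_mem_box {h : ℝ} (z : Eu N)
    (hz : ∀ i, z i ∈ Set.Ico (-h) (-h + 2 * h)) : ‖z‖ ^ 2 ≤ N * h ^ 2 := by
  rw [EuclideanSpace.norm_sq_eq]
  calc ∑ i, ‖z i‖ ^ 2 ≤ ∑ _i : Fin N, h ^ 2 := Finset.sum_le_sum fun i _ => by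
        rw [Real.norm_eq_abs]
        refine pow_le_pow_left₀ (abs_nonneg _) (abs_le.2 ⟨(hz i).1, ?_⟩) 2
        have := (hz i).2
        linarith
    _ = N * h ^ 2 := by simp

/-- A `C¹` function with compact support is approximated in
`L²` by a function that is constant on the cubes of side `h`. -/
theorem exists_cell_approx {φ : Eu N → ℝ} (hφ : ContDiff ℝ 1 φ) (hc : HasCompactSupport φ)
    {h : ℝ} (hh : 0 < h) : ∃ a : (Fin N → ℤ) → ℝ,
      ∫⁻ x, ‖φ x - a (cellIndex h x)‖ₑ ^ 2 ≤
        ENNReal.ofReal (2 ^ N * (N * h ^ 2)) * ∫⁻ x, ‖fderiv ℝ φ x‖ₑ ^ 2 := by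
  set Q : (Fin N → ℤ) → Set (Eu N) := fun n => {y | cellIndex h y = n} with hQ
  set B : Set (Eu N) := {z | ∀ i, z i ∈ Set.Ico (-h) (-h + 2 * h)} with hB
  have hQm : ∀ n, MeasurableSet (Q n) := fun n =>
    measurable_cellIndex h (MeasurableSet.of_discrete (s := {n}))
  have hBm : MeasurableSet B := measurableSet_box _ _
  have hQv : ∀ n, volume (Q n) = ENNReal.ofReal h ^ N := fun n => by
    rw [← volume_box (fun i => n i * h) h]
    congr 1
    ext y
    exact cellIndex_eq_iff hh y n
  set v : ℝ≥0∞ := ENNReal.ofReal h ^ N with hv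
  have hv0 : v ≠ 0 := pow_ne_zero _ (by simpa using hh)
  have hvt : v ≠ ⊤ := ENNReal.pow_ne_top ENNReal.ofReal_ne_top
  have hφi : Integrable φ := hφ.continuous.integrable_of_hasCompactSupport hc
  have hφm : Measurable φ := hφ.continuous.measurable
  -- The constant on each cube is the mean of `φ` there.
  refine ⟨fun n => v.toReal⁻¹ * ∫ y in Q n, φ y, ?_⟩
  have hpt : ∀ x, ‖φ x - v.toReal⁻¹ * ∫ y in Q (cellIndex h x), φ y‖ₑ ^ 2 ≤
      v⁻¹ * ∫⁻ z in B, ‖φ (x + z) - φ x‖ₑ ^ 2 := by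
    intro x
    set n := cellIndex h x with hn
    have h1 : φ x - v.toReal⁻¹ * ∫ y in Q n, φ y = v.toReal⁻¹ * ∫ y in Q n, (φ x - φ y) := by
      have hvr : v.toReal ≠ 0 := ENNReal.toReal_ne_zero.2 ⟨hv0, hvt⟩
      have hci : IntegrableOn (fun _ => φ x) (Q n) := integrableOn_const (by rw [hQv]; exact hvt)
      rw [integral_sub hci hφi.integrableOn,
        setIntegral_const, measureReal_def, hQv, smul_eq_mul]
      field_simp
    have h2 : ‖v.toReal⁻¹‖ₑ = v⁻¹ := by
      rw [Real.enorm_of_nonneg (by positivity), ENNReal.ofReal_inv_of_pos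
        (ENNReal.toReal_pos hv0 hvt), ENNReal.ofReal_toReal hvt]
    have h3 : ‖∫ y in Q n, (φ x - φ y)‖ₑ ^ 2 ≤ v * ∫⁻ y in Q n, ‖φ x - φ y‖ₑ ^ 2 := by
      calc _ ≤ (∫⁻ y in Q n, ‖φ x - φ y‖ₑ) ^ 2 := by
            gcongr
            exact enorm_integral_le_lintegral_enorm _
        _ ≤ _ := by
            refine (sq_lintegral_le _ ((measurable_const.sub hφm).enorm.aemeasurable)).trans ?_
            rw [Measure.restrict_apply_univ, hQv]
            rfl
    -- Substitute `y = x + z`: two points of one cube differ by an element of `B`, a cube of side `2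
    -- * h` that does not depend on `x`. This allows the order of integration to be swapped below.
    have h4 : ∫⁻ y in Q n, ‖φ x - φ y‖ₑ ^ 2 ≤ ∫⁻ z in B, ‖φ (x + z) - φ x‖ₑ ^ 2 := by
      rw [← lintegral_indicator (hQm n), ← lintegral_indicator hBm,
        ← lintegral_add_left_eq_self _ x]
      refine lintegral_mono fun z => ?_
      by_cases hz : x + z ∈ Q n
      · have hzB : z ∈ B := by
          intro i
          have e1 := (cellIndex_eq_iff hh x n).1 rfl i
          have e2 := (cellIndex_eq_iff hh (x + z) n).1 hz i
          simp only [PiLp.add_apply, Set.mem_Ico] at e1 e2 ⊢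
          constructor <;> linarith [e1.1, e1.2, e2.1, e2.2]
        rw [Set.indicator_of_mem hz, Set.indicator_of_mem hzB, enorm_sub_rev]
      · rw [Set.indicator_of_notMem hz]
        exact zero_le
    rw [h1, enorm_mul, mul_pow, h2]
    calc _ ≤ v⁻¹ ^ 2 * (v * ∫⁻ z in B, ‖φ (x + z) - φ x‖ₑ ^ 2) := by
          gcongr
          exact h3.trans (by gcongr)
      _ = (v⁻¹ * v) * (v⁻¹ * ∫⁻ z in B, ‖φ (x + z) - φ x‖ₑ ^ 2) := by ring
      _ = _ := by rw [ENNReal.inv_mul_cancel hv0 hvt, one_mul]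
  have hm : Measurable fun p : Eu N × Eu N => ‖φ (p.1 + p.2) - φ p.1‖ₑ ^ 2 :=
    (((hφm.comp (measurable_fst.add measurable_snd)).sub
      (hφm.comp measurable_fst)).enorm).pow_const 2
  calc _ ≤ ∫⁻ x, v⁻¹ * ∫⁻ z in B, ‖φ (x + z) - φ x‖ₑ ^ 2 := lintegral_mono hpt
    _ = v⁻¹ * ∫⁻ z in B, ∫⁻ x, ‖φ (x + z) - φ x‖ₑ ^ 2 := by
        rw [lintegral_const_mul' _ _ (ENNReal.inv_ne_top.2 hv0),
          lintegral_lintegral_swap hm.aemeasurable]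
    _ ≤ v⁻¹ * ∫⁻ _z in B, ENNReal.ofReal (N * h ^ 2) * ∫⁻ x, ‖fderiv ℝ φ x‖ₑ ^ 2 := by
        refine mul_le_mul_right ?_ _
        refine setLIntegral_mono measurable_const fun z hz => ?_
        refine (lintegral_enorm_sub_sq_le hφ z).trans ?_
        gcongr
        rw [← ofReal_norm, ← ENNReal.ofReal_pow (norm_nonneg _)]
        exact ENNReal.ofReal_le_ofReal (norm_sq_le_of_mem_box z hz)
    -- The factor `2 ^ N` is the ratio of the volumes of `B` and of a cell.
    _ = (v⁻¹ * v) * (2 ^ N * (ENNReal.ofReal (N * h ^ 2) * ∫⁻ x, ‖fderiv ℝ φ x‖ₑ ^ 2)) := by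
        rw [setLIntegral_const, hB, volume_box (fun _ => -h) (2 * h),
          ENNReal.ofReal_mul zero_le_two, mul_pow, ← hv, ENNReal.ofReal_ofNat]
        ring
    _ = _ := by
        rw [ENNReal.inv_mul_cancel hv0 hvt, one_mul,
          ENNReal.ofReal_mul (p := 2 ^ N) (by positivity),
          ENNReal.ofReal_pow zero_le_two, ENNReal.ofReal_ofNat, mul_assoc]

end Cells

/-! ### Compactness and infinite rank of the embedding into `L²`. -/

section Embedding

variable {N : ℕ} {Ω : Set (Eu N)}

/-- The embedding `H¹₀(Ω) → L²(Ω)`. -/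
noncomputable def embedL2 (Ω : Set (Eu N)) : H10 Ω →L[ℝ] Lp ℝ 2 (volume.restrict Ω) :=
  (WithLp.fstL 2 ℝ (Lp ℝ 2 (volume.restrict Ω)) (Lp (Eu N) 2 (volume.restrict Ω))) ∘L
    (H10sub Ω).subtypeL

theorem embedL2_apply (u : H10 Ω) : embedL2 Ω u = u.fn := rfl

theorem norm_sq_eq (u : H10 Ω) : ‖u‖ ^ 2 = ‖u.fn‖ ^ 2 + ‖u.grad‖ ^ 2 :=
  WithLp.prod_norm_sq_eq_of_L2 (u : L2Pair Ω)

theorem inner_eq (u v : H10 Ω) :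
    inner ℝ u v = inner ℝ u.fn v.fn + inner ℝ u.grad v.grad := rfl

theorem norm_grad_le (u : H10 Ω) : ‖u.grad‖ ≤ ‖u‖ := by
  have := norm_sq_eq u
  exact (sq_le_sq₀ (norm_nonneg _) (norm_nonneg _)).1 (by linarith [sq_nonneg ‖u.fn‖])

theorem norm_gradient (φ : Eu N → ℝ) (x : Eu N) : ‖gradient φ x‖ = ‖fderiv ℝ φ x‖ :=
  (InnerProductSpace.toDual ℝ (Eu N)).symm.norm_map _

/-- Closed conditions on `H¹₀(Ω)` may be checked on test functions. -/
theorem H10.induction {P : H10 Ω → Prop} (hP : IsClosed {u | P u})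
    (h : ∀ (φ : Eu N → ℝ), ContDiff ℝ ∞ φ → HasCompactSupport φ → tsupport φ ⊆ Ω →
      ∀ u : H10 Ω, u.fn =ᵐ[volume.restrict Ω] φ → u.grad =ᵐ[volume.restrict Ω] gradient φ → P u)
    (u : H10 Ω) : P u := by
  have hd : Dense {u : H10 Ω | (u : L2Pair Ω) ∈ testPairs Ω} := by
    intro u
    rw [closure_subtype]
    have h1 : ((↑) : H10 Ω → L2Pair Ω) '' {u : H10 Ω | (u : L2Pair Ω) ∈ testPairs Ω} =
        testPairs Ω := by
      ext w
      constructor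
      · rintro ⟨v, hv, rfl⟩
        exact hv
      · intro hw
        exact ⟨⟨w, (testPairs Ω).le_topologicalClosure hw⟩, hw, rfl⟩
    rw [h1]
    exact u.2
  refine (hP.closure_eq ▸ closure_mono (fun v hv => ?_) : closure _ ⊆ {u | P u}) (hd u)
  obtain ⟨φ, h1, h2, h3, h4, h5⟩ := hv
  exact h φ h1 h2 h3 v h4 h5

theorem finite_cellIndex_image (hΩ : Bornology.IsBounded Ω) {h : ℝ} (hh : 0 < h) :
    (cellIndex h '' Ω).Finite := by
  obtain ⟨R, hR⟩ := hΩ.subset_closedBall 0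
  refine (Set.Finite.pi' (t := fun _ : Fin N => Set.Icc ⌊-R / h⌋ ⌊R / h⌋)
    fun _ => Set.finite_Icc _ _).subset ?_
  rintro _ ⟨x, hx, rfl⟩ i
  have h1 : ‖x‖ ≤ R := by simpa using hR hx
  have h2 : |x i| ≤ R := by
    rw [← Real.norm_eq_abs]
    exact (PiLp.norm_apply_le x i).trans h1
  rw [abs_le] at h2
  exact ⟨Int.floor_le_floor (by gcongr; exact h2.1), Int.floor_le_floor (by gcongr; exact h2.2)⟩

theorem ofReal_norm_sq_eq_lintegral {α F : Type*} [MeasurableSpace α] [NormedAddCommGroup F]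
    {μ : Measure α} (f : Lp F 2 μ) : ENNReal.ofReal (‖f‖ ^ 2) = ∫⁻ x, ‖f x‖ₑ ^ 2 ∂μ := by
  have h := eLpNorm_nnreal_pow_eq_lintegral (μ := μ) (f := f) (p := 2) two_ne_zero
  rw [ENNReal.ofReal_pow (norm_nonneg _), ofReal_norm, Lp.enorm_def]
  simpa only [NNReal.coe_ofNat, ENNReal.rpow_two, ENNReal.coe_ofNat] using h

theorem isCompactOperator_starProjection {L : Type*} [NormedAddCommGroup L]
    [InnerProductSpace ℝ L] (W : Submodule ℝ L) [FiniteDimensional ℝ W] :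
    IsCompactOperator W.starProjection := by
  have : ProperSpace W := FiniteDimensional.proper ℝ W
  have h1 : IsCompactOperator (W.subtypeL : W → L) :=
    (isCompactOperator_id (E := W)).clm_comp W.subtypeL
  exact h1.comp_clm W.orthogonalProjectionOnto

section Step

variable [IsFiniteMeasure (volume.restrict Ω)]

/-- The indicator function of a cube of side `h`, restricted to `Ω`. -/
noncomputable def cellIndicator (Ω : Set (Eu N)) [IsFiniteMeasure (volume.restrict Ω)] (h : ℝ)
    (n : Fin N → ℤ) : Lp ℝ 2 (volume.restrict Ω) :=
  indicatorConstLp 2 (measurable_cellIndex h (MeasurableSet.of_discrete (s := {n})))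
    (measure_ne_top _ _) (1 : ℝ)

theorem sum_cellIndicator_ae (hΩo : IsOpen Ω) {h : ℝ} {S : Finset (Fin N → ℤ)}
    (hS : ∀ x ∈ Ω, cellIndex h x ∈ S) (a : (Fin N → ℤ) → ℝ) :
    (∑ n ∈ S, a n • cellIndicator Ω h n : Lp ℝ 2 (volume.restrict Ω)) =ᵐ[volume.restrict Ω]
      fun x => a (cellIndex h x) := by
  have h1 : ∀ᵐ x ∂volume.restrict Ω, ∀ n ∈ S,
      (a n • cellIndicator Ω h n : Lp ℝ 2 (volume.restrict Ω)) x =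
        a n * Set.indicator (cellIndex h ⁻¹' {n}) (fun _ => (1 : ℝ)) x := by
    refine (Finset.eventually_all S).2 fun n _ => ?_
    have e := indicatorConstLp_coeFn (p := 2)
      (hs := measurable_cellIndex (N := N) h (MeasurableSet.of_discrete (s := {n})))
      (hμs := measure_ne_top (volume.restrict Ω) _) (c := (1 : ℝ))
    filter_upwards [Lp.coeFn_smul (a n) (cellIndicator Ω h n), e] with x e1 e2
    rw [e1, Pi.smul_apply, smul_eq_mul, ← e2]
    rfl
  filter_upwards [h1, Lp.coeFn_finsetSum S fun n => a n • cellIndicator Ω h n,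
    ae_restrict_mem hΩo.measurableSet] with x e1 e2 hx
  rw [e2, Finset.sum_apply, Finset.sum_congr rfl e1,
    Finset.sum_eq_single_of_mem (cellIndex h x) (hS x hx)]
  · simp
  · intro n _ hn
    rw [Set.indicator_of_notMem (fun hx' => hn hx'.symm), mul_zero]

/-- The cell approximation read in `L²(Ω)`. The derivative of `φ` vanishes off `Ω`, so its integral
over the whole space is `‖u.grad‖ ^ 2`. -/
theorem exists_norm_sub_sum_cellIndicator_le (hΩo : IsOpen Ω) {h : ℝ} (hh : 0 < h)
    {S : Finset (Fin N → ℤ)} (hS : ∀ x ∈ Ω, cellIndex h x ∈ S) {φ : Eu N → ℝ}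
    (hφ : ContDiff ℝ ∞ φ) (hc : HasCompactSupport φ) (hsupp : tsupport φ ⊆ Ω) {u : H10 Ω}
    (hu : u.fn =ᵐ[volume.restrict Ω] φ) (hgu : u.grad =ᵐ[volume.restrict Ω] gradient φ) :
    ∃ a : (Fin N → ℤ) → ℝ, ‖u.fn - ∑ n ∈ S, a n • cellIndicator Ω h n‖ ^ 2 ≤
      2 ^ N * (N * h ^ 2) * ‖u.grad‖ ^ 2 := by
  obtain ⟨a, ha⟩ := exists_cell_approx (hφ.of_le (by exact_mod_cast le_top)) hc hh
  refine ⟨a, ?_⟩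
  have hsuppf : ∀ x ∉ Ω, fderiv ℝ φ x = 0 := fun x hx =>
    image_eq_zero_of_notMem_tsupport fun hx' => hx (hsupp (tsupport_fderiv_subset ℝ hx'))
  have hgrad : ∫⁻ x, ‖fderiv ℝ φ x‖ₑ ^ 2 = ENNReal.ofReal (‖u.grad‖ ^ 2) := by
    rw [ofReal_norm_sq_eq_lintegral, ← setLIntegral_eq_of_support_subset (s := Ω)]
    · refine lintegral_congr_ae ?_
      filter_upwards [hgu] with x hx
      rw [hx, ← ofReal_norm, ← ofReal_norm, norm_gradient]
    · intro x hx
      by_contra hxΩ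
      refine hx ?_
      simp only [hsuppf x hxΩ, ← ofReal_norm, norm_zero]
      simp
  rw [← ENNReal.ofReal_le_ofReal_iff (by positivity), ENNReal.ofReal_mul (by positivity), ← hgrad,
    ofReal_norm_sq_eq_lintegral]
  refine le_trans ?_ ha
  refine le_trans (le_of_eq (lintegral_congr_ae ?_)) (setLIntegral_le_lintegral Ω _)
  filter_upwards [Lp.coeFn_sub u.fn (∑ n ∈ S, a n • cellIndicator Ω h n), hu,
    sum_cellIndicator_ae hΩo hS a] with x e1 e2 e3
  rw [e1, Pi.sub_apply, e2, e3]

end Step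

/-- The embedding of `H¹₀(Ω)` into `L²(Ω)` is approximated by compact operators. -/
theorem exists_isCompactOperator_approx (hΩo : IsOpen Ω) (hΩ : Bornology.IsBounded Ω) {h : ℝ}
    (hh : 0 < h) : ∃ P : Lp ℝ 2 (volume.restrict Ω) →L[ℝ] Lp ℝ 2 (volume.restrict Ω),
      IsCompactOperator P ∧
        ∀ u : H10 Ω, ‖u.fn - P u.fn‖ ≤ Real.sqrt (2 ^ N * (N * h ^ 2)) * ‖u‖ := by
  have : IsFiniteMeasure (volume.restrict Ω) :=
    ⟨by rw [Measure.restrict_apply_univ]; exact hΩ.measure_lt_top⟩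
  set S : Finset (Fin N → ℤ) := (finite_cellIndex_image hΩ hh).toFinset
  have hS : ∀ x ∈ Ω, cellIndex h x ∈ S := fun x hx => by simpa [S] using ⟨x, hx, rfl⟩
  set W := Submodule.span ℝ (cellIndicator Ω h '' (S : Set (Fin N → ℤ)))
  have : FiniteDimensional ℝ W :=
    FiniteDimensional.span_of_finite ℝ (S.finite_toSet.image _)
  refine ⟨W.starProjection, isCompactOperator_starProjection W, H10.induction ?_ ?_⟩
  · have h1 : Continuous fun u : H10 Ω => u.fn := (embedL2 Ω).continuous
    exact isClosed_le (h1.sub (W.starProjection.continuous.comp h1)).norm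
      (continuous_const.mul continuous_norm)
  intro φ hφ hc hsupp u hu hgu
  obtain ⟨a, ha⟩ := exists_norm_sub_sum_cellIndicator_le hΩo hh hS hφ hc hsupp hu hgu
  set w := ∑ n ∈ S, a n • cellIndicator Ω h n
  have hwW : w ∈ W := Submodule.sum_mem _ fun n hn =>
    Submodule.smul_mem _ _ (Submodule.subset_span ⟨n, hn, rfl⟩)
  -- The projection onto `W` is the best approximation from `W`, so it does at least as well as the
  -- cell averages; unlike them it is given directly as a linear operator on `L²`.
  calc ‖u.fn - W.starProjection u.fn‖ ≤ ‖u.fn - w‖ := by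
        rw [Submodule.starProjection_minimal]
        exact ciInf_le ⟨0, by rintro _ ⟨y, rfl⟩; positivity⟩ (⟨w, hwW⟩ : W)
    _ ≤ Real.sqrt (2 ^ N * (N * h ^ 2) * ‖u.grad‖ ^ 2) := Real.le_sqrt_of_sq_le ha
    _ = Real.sqrt (2 ^ N * (N * h ^ 2)) * ‖u.grad‖ := by
        rw [Real.sqrt_mul (by positivity), Real.sqrt_sq (norm_nonneg _)]
    _ ≤ _ := by gcongr; exact norm_grad_le u

theorem isCompactOperator_of_approx {E F : Type*} [NormedAddCommGroup E] [NormedSpace ℝ E]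
    [NormedAddCommGroup F] [NormedSpace ℝ F] [CompleteSpace F] {T : E →L[ℝ] F} {P : ℕ → E →L[ℝ] F}
    {c : ℕ → ℝ} (hP : ∀ n, IsCompactOperator (P n)) (hc0 : ∀ n, 0 ≤ c n)
    (hc : Tendsto c atTop (𝓝 0)) (h : ∀ n u, ‖T u - P n u‖ ≤ c n * ‖u‖) : IsCompactOperator T := by
  have hlim : Tendsto P atTop (𝓝 T) := by
    rw [tendsto_iff_norm_sub_tendsto_zero]
    refine squeeze_zero (fun _ => norm_nonneg _) (fun n => ?_) hc
    refine ContinuousLinearMap.opNorm_le_bound _ (hc0 n) fun u => ?_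
    have h1 := h n u
    rw [norm_sub_rev] at h1
    exact h1
  exact isCompactOperator_of_tendsto hlim (Eventually.of_forall hP)

/-- **Rellich's theorem** for `H¹₀(Ω)`. -/
theorem isCompactOperator_embedL2 (hΩo : IsOpen Ω) (hΩ : Bornology.IsBounded Ω) :
    IsCompactOperator (embedL2 Ω) := by
  have hpos : ∀ n : ℕ, (0 : ℝ) < 1 / (n + 1) := fun n => by positivity
  choose P hPc hP using fun n : ℕ => exists_isCompactOperator_approx hΩo hΩ (hpos n)
  have hlim : Tendsto (fun n : ℕ => Real.sqrt (2 ^ N * (N * (1 / ((n : ℝ) + 1)) ^ 2))) atTop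
      (𝓝 0) := by
    have h1 := (((tendsto_one_div_add_atTop_nhds_zero_nat (𝕜 := ℝ)).pow 2).const_mul
      (N : ℝ)).const_mul ((2 : ℝ) ^ N)
    simpa using h1.sqrt
  exact isCompactOperator_of_approx (E := H10 Ω) (F := Lp ℝ 2 (volume.restrict Ω))
    (T := embedL2 Ω) (P := fun n => P n ∘L embedL2 Ω)
    (fun n => (hPc n).comp_clm (embedL2 Ω)) (fun n => Real.sqrt_nonneg _) hlim hP

/-- The element of `H¹₀(Ω)` given by a test function. -/
theorem exists_H10_of_test {φ : Eu N → ℝ} (hφ : ContDiff ℝ ∞ φ) (hc : HasCompactSupport φ)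
    (hs : tsupport φ ⊆ Ω) : ∃ u : H10 Ω, u.fn =ᵐ[volume.restrict Ω] φ := by
  have h1 : MemLp φ 2 (volume.restrict Ω) :=
    (hφ.continuous.memLp_of_hasCompactSupport hc).restrict Ω
  have hg : Continuous (gradient φ) :=
    (InnerProductSpace.toDual ℝ (Eu N)).symm.continuous.comp (hφ.continuous_fderiv (by simp))
  have hgc : HasCompactSupport (gradient φ) :=
    (hc.fderiv ℝ).comp_left (g := (InnerProductSpace.toDual ℝ (Eu N)).symm) (map_zero _)
  have h2 : MemLp (gradient φ) 2 (volume.restrict Ω) :=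
    (hg.memLp_of_hasCompactSupport hgc).restrict Ω
  refine ⟨⟨WithLp.toLp 2 (h1.toLp φ, h2.toLp (gradient φ)), (testPairs Ω).le_topologicalClosure
    ⟨φ, hφ, hc, hs, h1.coeFn_toLp, h2.coeFn_toLp⟩⟩, h1.coeFn_toLp⟩

/-- Bump functions supported in infinitely many disjoint open subsets of `Ω` are orthogonal in `L²`.
-/
theorem not_finiteDimensional_range_embedL2 (hN : 0 < N) (hΩo : IsOpen Ω) (hΩ : Ω.Nonempty) :
    ¬ FiniteDimensional ℝ (LinearMap.range (embedL2 Ω : H10 Ω →ₗ[ℝ] Lp ℝ 2 (volume.restrict Ω))) := by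
  intro hfin
  have : Nonempty (Fin N) := ⟨⟨0, hN⟩⟩
  have hinf : Infinite Ω := (infinite_of_mem_nhds hΩ.some
    (hΩo.mem_nhds hΩ.some_mem)).to_subtype
  obtain ⟨U, hU1, hU2, hU3⟩ := exists_seq_infinite_isOpen_pairwise_disjoint Ω
  have hex : ∀ n, ∃ u : H10 Ω, u.fn ≠ 0 ∧
      ∀ᵐ x ∂volume.restrict Ω, u.fn x ≠ 0 → ∃ y ∈ U n, (y : Eu N) = x := by
    intro n
    obtain ⟨⟨x, hxΩ⟩, hx⟩ := (hU1 n).nonempty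
    have hO : IsOpen (((↑) : Ω → Eu N) '' U n) := hΩo.isOpenMap_subtype_val _ (hU2 n)
    obtain ⟨φ, hφ1, hφ2, hφ3, -, hφ5⟩ := exists_contDiff_tsupport_subset (n := ⊤)
      (hO.mem_nhds ⟨_, hx, rfl⟩)
    obtain ⟨u, hu⟩ := exists_H10_of_test hφ3 hφ2
      (hφ1.trans (by rintro _ ⟨y, -, rfl⟩; exact y.2))
    refine ⟨u, fun h0 => ?_, ?_⟩
    · have h1 : φ =ᵐ[volume.restrict Ω] 0 := by
        rw [h0] at hu
        exact hu.symm.trans (Lp.coeFn_zero _ _ _)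
      have h2 := Measure.eqOn_open_of_ae_eq h1 hΩo hφ3.continuous.continuousOn continuousOn_const
      have := h2 hxΩ
      simp [hφ5] at this
    · filter_upwards [hu] with y hy h0
      rw [hy] at h0
      exact hφ1 (subset_tsupport _ h0)
  choose u hu0 hus using hex
  have horth : Pairwise fun i j => inner ℝ (u i).fn (u j).fn = 0 := by
    intro i j hij
    rw [L2.inner_def]
    refine integral_eq_zero_of_ae ?_
    filter_upwards [hus i, hus j] with x hi hj
    by_cases h1 : (u i).fn x = 0
    · simp [h1]
    by_cases h2 : (u j).fn x = 0
    · simp [h2]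
    obtain ⟨y, hy, hyx⟩ := hi h1
    obtain ⟨z, hz, hzx⟩ := hj h2
    obtain rfl : y = z := Subtype.ext (hyx.trans hzx.symm)
    exact (Set.disjoint_left.1 (hU3 hij) hy hz).elim
  have hli : LinearIndependent ℝ fun n => (u n).fn :=
    linearIndependent_of_ne_zero_of_inner_eq_zero hu0 horth
  have hli' : LinearIndependent ℝ fun n =>
      (⟨(u n).fn, u n, rfl⟩ : LinearMap.range (embedL2 Ω : H10 Ω →ₗ[ℝ] Lp ℝ 2 (volume.restrict Ω))) :=
    LinearIndependent.of_comp (LinearMap.range (embedL2 Ω : H10 Ω →ₗ[ℝ] Lp ℝ 2 (volume.restrict Ω))).subtype hli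
  have := hli'.finite
  exact not_finite ℕ

end Embedding

open Module

/-! ### Abstract spectral theory of a compact map `ι`. -/

section Spectral

variable {E L : Type*} [NormedAddCommGroup E] [InnerProductSpace ℝ E]
  [NormedAddCommGroup L] [InnerProductSpace ℝ L]

/-- A compact symmetric operator whose eigenvalues are bounded by `r` in absolute value has norm
at most `r`. -/
theorem norm_le_of_forall_hasEigenvalue [CompleteSpace E] {T : E →L[ℝ] E} (hT : IsCompactOperator T)
    (hs : T.IsSymmetric) {r : ℝ} (hr : 0 ≤ r)
    (h : ∀ τ, End.HasEigenvalue (T : End ℝ E) τ → |τ| ≤ r) : ‖T‖ ≤ r := by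
  lift r to NNReal using hr
  have key : spectralRadius ℝ T ≤ r := by
    -- For a compact operator every nonzero point of the spectrum is an eigenvalue; for a
    -- self-adjoint one the spectral radius is the norm.
    refine iSup₂_le fun τ hτ => ?_
    rcases eq_or_ne τ 0 with rfl | h0
    · simp
    · have := h τ ((hT.hasEigenvalue_iff_mem_spectrum h0).2 hτ)
      exact_mod_cast this
  rw [T.spectralRadius_eq_nnnorm hs.isSelfAdjoint] at key
  exact_mod_cast key

variable {ι : E →L[ℝ] L} {V : ℝ → Submodule ℝ E}

/-- `hV` is the weak eigenvalue equation with the `L²` product added to both sides, whence `1 + μ`.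
The two equations evaluate the same number `⟨u, v⟩`. -/
theorem inner_eq_zero_of_mem_of_mem
    (hV : ∀ μ u, u ∈ V μ ↔ ∀ v, inner ℝ u v = (1 + μ) * inner ℝ (ι u) (ι v))
    {μ ν : ℝ} (hμν : μ ≠ ν) {u v : E} (hu : u ∈ V μ) (hv : v ∈ V ν) :
    inner ℝ (ι u) (ι v) = 0 := by
  have h1 := (hV μ u).1 hu v
  have h2 := (hV ν v).1 hv u
  rw [real_inner_comm, real_inner_comm (ι u)] at h2
  have h3 : (μ - ν) * inner ℝ (ι u) (ι v) = 0 := by linarith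
  exact (mul_eq_zero.1 h3).resolve_left (sub_ne_zero.2 hμν)

/-- On the sum of the eigenspaces with `μ ≤ Λ`, the form is bounded by `1 + Λ`. -/
theorem norm_sq_le_of_mem_iSup
    (hV : ∀ μ u, u ∈ V μ ↔ ∀ v, inner ℝ u v = (1 + μ) * inner ℝ (ι u) (ι v))
    {Λ : ℝ} {u : E} (hu : u ∈ ⨆ μ : Set.Iic Λ, V μ) :
    ‖u‖ ^ 2 ≤ (1 + Λ) * ‖ι u‖ ^ 2 := by
  obtain ⟨w, hw, rfl⟩ := (Submodule.mem_iSup_iff_exists_finsupp _ _).1 hu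
  have horth : ∀ i j : Set.Iic Λ, i ≠ j → inner ℝ (ι (w i)) (ι (w j)) = 0 := fun i j hij =>
    inner_eq_zero_of_mem_of_mem hV (fun h => hij (Subtype.ext h)) (hw i) (hw j)
  have h1 : ∀ i ∈ w.support,
      ∑ j ∈ w.support, inner ℝ (ι (w j)) (ι (w i)) = ‖ι (w i)‖ ^ 2 := by
    intro i hi
    rw [Finset.sum_eq_single_of_mem i hi fun j _ hj => horth j i hj,
      real_inner_self_eq_norm_sq]
  rw [← real_inner_self_eq_norm_sq, ← real_inner_self_eq_norm_sq, Finsupp.sum, map_sum]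
  simp only [sum_inner, inner_sum]
  rw [Finset.mul_sum]
  refine Finset.sum_le_sum fun i hi => ?_
  rw [h1 i hi]
  have h3 : ∑ j ∈ w.support, inner ℝ (w j) (w i) = (1 + (i : ℝ)) * ‖ι (w i)‖ ^ 2 := by
    rw [← h1 i hi, Finset.mul_sum]
    exact Finset.sum_congr rfl fun j _ => by
      rw [real_inner_comm, (hV _ _).1 (hw i), real_inner_comm]
  rw [h3]
  have : (i : ℝ) ≤ Λ := i.2
  gcongr

/-- Eigenvalues bounded above have finite total multiplicity. -/
theorem finiteDimensional_iSup_eigenspaces (hι : IsCompactOperator ι)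
    (hV : ∀ μ u, u ∈ V μ ↔ ∀ v, inner ℝ u v = (1 + μ) * inner ℝ (ι u) (ι v)) (Λ : ℝ) :
    FiniteDimensional ℝ (⨆ μ : Set.Iic Λ, V μ : Submodule ℝ E) := by
  set W : Submodule ℝ E := ⨆ μ : Set.Iic Λ, V μ
  let f : W →L[ℝ] L := ι ∘L W.subtypeL
  -- On `W` the full norm is controlled by the image under a compact map, so the unit ball of `W` is
  -- totally bounded and Riesz's theorem applies.
  have hf : ∀ w : W, ‖w‖ ≤ Real.sqrt (1 + |Λ|) * ‖f w‖ := by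
    intro w
    have h1 := norm_sq_le_of_mem_iSup hV w.2
    have h2 : (1 + Λ) * ‖ι w‖ ^ 2 ≤ (1 + |Λ|) * ‖ι w‖ ^ 2 := by gcongr; exact le_abs_self Λ
    have h3 : ‖(w : E)‖ ^ 2 ≤ (Real.sqrt (1 + |Λ|) * ‖ι w‖) ^ 2 := by
      rw [mul_pow, Real.sq_sqrt (by positivity)]
      exact h1.trans h2
    exact (sq_le_sq₀ (norm_nonneg _) (by positivity)).1 h3
  have hanti : AntilipschitzWith (Real.toNNReal (Real.sqrt (1 + |Λ|))) f :=
    AddMonoidHomClass.antilipschitz_of_bound f fun w => by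
      rw [Real.coe_toNNReal _ (Real.sqrt_nonneg _)]
      exact hf w
  have hind : IsUniformInducing f := hanti.isUniformInducing f.uniformContinuous
  have hc : IsCompact (closure (ι '' Metric.closedBall 0 1)) :=
    IsCompactOperator.isCompact_closure_image_closedBall (f := (ι : E →ₗ[ℝ] L)) hι 1
  have htb : TotallyBounded (f ⁻¹' (ι '' Metric.closedBall 0 1)) :=
    totallyBounded_preimage hind (hc.totallyBounded.subset subset_closure)
  refine FiniteDimensional.of_totallyBounded_nhds_zero ℝ
    (Metric.closedBall_mem_nhds (0 : W) one_pos) (htb.subset fun w hw => ?_)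
  exact ⟨w, by simpa using hw, rfl⟩

variable [CompleteSpace E] [CompleteSpace L]

/-- On the orthogonal complement of the eigenvectors with `μ ≤ Λ`, the form is bounded below by
`1 + Λ`. -/
theorem norm_sq_ge_of_mem_orthogonal (hι : IsCompactOperator ι)
    (hV : ∀ μ u, u ∈ V μ ↔ ∀ v, inner ℝ u v = (1 + μ) * inner ℝ (ι u) (ι v))
    {Λ : ℝ} (hΛ : 0 ≤ Λ) {u : E} (hu : u ∈ (⨆ μ : Set.Iic Λ, V μ)ᗮ) :
    (1 + Λ) * ‖ι u‖ ^ 2 ≤ ‖u‖ ^ 2 := by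
  set W : Submodule ℝ E := ⨆ μ : Set.Iic Λ, V μ with hWdef
  let T : E →L[ℝ] E := ι.adjoint ∘L ι
  have hTi : ∀ x y, inner ℝ (T x) y = inner ℝ (ι x) (ι y) := fun x y =>
    ι.adjoint_inner_left y (ι x)
  have hTc : IsCompactOperator T := hι.clm_comp ι.adjoint
  have hTs : T.IsSymmetric := fun x y => by
    change inner ℝ (T x) y = inner ℝ x (T y)
    rw [hTi, real_inner_comm, ← hTi, real_inner_comm]
  have hinv : ∀ x ∈ Wᗮ, T x ∈ Wᗮ := by
    intro x hx
    rw [hWdef, ← Submodule.iInf_orthogonal, Submodule.mem_iInf] at hx ⊢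
    intro μ w hw
    rw [real_inner_comm, hTi, real_inner_comm]
    have h1 := (hV _ _).1 hw x
    rw [hx μ w hw] at h1
    rcases mul_eq_zero.1 h1.symm with h2 | h2
    -- In the degenerate case `1 + μ = 0` the eigenvector is zero.
    · have h3 := (hV _ _).1 hw w
      rw [h2, zero_mul, inner_self_eq_zero] at h3
      rw [h3, map_zero, inner_zero_left]
    · exact h2
  let S : Wᗮ →L[ℝ] Wᗮ := T.restrict hinv
  have hSc : IsCompactOperator S := hTc.restrict' hinv
  have hSs : S.IsSymmetric := hTs.restrict_invariant hinv
  -- An eigenvector of `S` with `τ > (1 + Λ)⁻¹` would lie in `V (τ⁻¹ - 1)` with `τ⁻¹ - 1 ≤ Λ`, hence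
  -- in both `W` and its orthogonal complement.
  have hS : ‖S‖ ≤ (1 + Λ)⁻¹ := by
    refine norm_le_of_forall_hasEigenvalue hSc hSs (by positivity) fun τ hτ => ?_
    obtain ⟨v, hv⟩ := hτ.exists_hasEigenvector
    have hv1 : T v = τ • (v : E) := congrArg Subtype.val hv.apply_eq_smul
    have hv0 : (v : E) ≠ 0 := fun h => hv.2 (Subtype.ext h)
    have h1 : τ * ‖(v : E)‖ ^ 2 = ‖ι v‖ ^ 2 := by
      rw [← real_inner_self_eq_norm_sq (ι v), ← hTi, hv1, real_inner_smul_left,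
        real_inner_self_eq_norm_sq]
    have hvp : 0 < ‖(v : E)‖ ^ 2 := by positivity
    have hτ0 : 0 ≤ τ := by
      by_contra hneg
      have := mul_neg_of_neg_of_pos (not_le.1 hneg) hvp
      have := sq_nonneg ‖ι v‖
      linarith
    rw [abs_of_nonneg hτ0]
    by_contra! hlt
    have hτp : 0 < τ := lt_trans (by positivity) hlt
    have hle : τ⁻¹ ≤ 1 + Λ := by
      rw [inv_le_comm₀ hτp (by positivity)]
      exact hlt.le
    have hmem : (v : E) ∈ V (τ⁻¹ - 1) := by
      rw [hV]
      intro y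
      rw [← hTi, hv1, real_inner_smul_left]
      field_simp
      ring
    have hW : (v : E) ∈ W :=
      Submodule.mem_iSup_of_mem (⟨τ⁻¹ - 1, by simp only [Set.mem_Iic]; linarith⟩ : Set.Iic Λ) hmem
    exact hv0 (inner_self_eq_zero.1 (v.2 v hW))
  have h2 : ‖ι u‖ ^ 2 ≤ (1 + Λ)⁻¹ * ‖u‖ ^ 2 := by
    rw [← real_inner_self_eq_norm_sq, ← hTi]
    calc inner ℝ (T u) u ≤ ‖T u‖ * ‖u‖ := real_inner_le_norm _ _
      _ = ‖S ⟨u, hu⟩‖ * ‖u‖ := rfl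
      _ ≤ ((1 + Λ)⁻¹ * ‖u‖) * ‖u‖ := by
          gcongr
          exact S.le_of_opNorm_le hS _
      _ = _ := by ring
  calc (1 + Λ) * ‖ι u‖ ^ 2 ≤ (1 + Λ) * ((1 + Λ)⁻¹ * ‖u‖ ^ 2) := by gcongr
    _ = ‖u‖ ^ 2 := by field_simp

/-- If the range of `ι` is infinite-dimensional, then the eigenvalues have infinite total
multiplicity. -/
theorem exists_le_finrank_iSup_eigenspaces (hι : IsCompactOperator ι)
    (hV : ∀ μ u, u ∈ V μ ↔ ∀ v, inner ℝ u v = (1 + μ) * inner ℝ (ι u) (ι v))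
    (hinf : ¬ FiniteDimensional ℝ (LinearMap.range (ι : E →ₗ[ℝ] L))) (k : ℕ) :
    ∃ Λ : ℝ, k ≤ finrank ℝ (⨆ μ : Set.Iic Λ, V μ : Submodule ℝ E) := by
  by_contra! hlt
  set W : ℝ → Submodule ℝ E := fun Λ => ⨆ μ : Set.Iic Λ, V μ
  have hfin : ∀ Λ, FiniteDimensional ℝ (W Λ) := finiteDimensional_iSup_eigenspaces hι hV
  have hmono : Monotone W := fun Λ Λ' h => iSup_le fun μ =>
    le_iSup (fun ν : Set.Iic Λ' => V ν) ⟨μ, le_trans μ.2 h⟩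
  have hbdd : BddAbove (Set.range fun Λ => finrank ℝ (W Λ)) :=
    ⟨k, by rintro _ ⟨Λ, rfl⟩; exact (hlt Λ).le⟩
  -- Bounded dimensions attain a maximum, beyond which `W` is constant. A vector orthogonal to `W
  -- Λ₀` then satisfies the lower bound for all large `Λ`, which forces `ι u = 0`; so `ι` has finite
  -- rank.
  obtain ⟨Λ₀, h₀⟩ := Nat.sSup_mem (Set.range_nonempty _) hbdd
  have hconst : ∀ Λ, Λ₀ ≤ Λ → W Λ₀ = W Λ := fun Λ h =>
    Submodule.eq_of_le_of_finrank_le (hmono h)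
      ((le_csSup hbdd ⟨Λ, rfl⟩).trans h₀.ge)
  have hker : ∀ u ∈ (W Λ₀)ᗮ, ι u = 0 := by
    intro u hu
    by_contra hne
    have hpos : 0 < ‖ι u‖ ^ 2 := by positivity
    set Λ := max (max Λ₀ 0) (‖u‖ ^ 2 / ‖ι u‖ ^ 2)
    have h1 : Λ₀ ≤ Λ := (le_max_left _ _).trans (le_max_left _ _)
    have h2 : 0 ≤ Λ := (le_max_right _ _).trans (le_max_left _ _)
    have h3 : ‖u‖ ^ 2 / ‖ι u‖ ^ 2 ≤ Λ := le_max_right _ _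
    rw [hconst Λ h1] at hu
    have h4 := norm_sq_ge_of_mem_orthogonal hι hV h2 hu
    rw [div_le_iff₀ hpos] at h3
    linarith
  refine hinf ?_
  have hle : LinearMap.range (ι : E →ₗ[ℝ] L) ≤ (W Λ₀).map (ι : E →ₗ[ℝ] L) := by
    rintro _ ⟨u, rfl⟩
    obtain ⟨y, hy, z, hz, rfl⟩ := (W Λ₀).exists_add_mem_mem_orthogonal u
    exact ⟨y, hy, by simp [hker z hz]⟩
  exact Submodule.finiteDimensional_of_le hle

end Spectral

/-! ### Dirichlet eigenvalues of `Ω`. -/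

section Eigenvalues

variable {N : ℕ} {Ω : Set (Eu N)}

instance completeSpace_H10 : CompleteSpace (H10 Ω) :=
  (Submodule.isClosed_topologicalClosure (testPairs Ω)).completeSpace_coe

theorem mem_eigenspace_iff_inner (μ : ℝ) (u : H10 Ω) : u ∈ eigenspace Ω μ ↔
    ∀ v : H10 Ω, inner ℝ u v = (1 + μ) * inner ℝ (embedL2 Ω u) (embedL2 Ω v) := by
  refine forall_congr' fun v => ?_
  rw [inner_eq, embedL2_apply, embedL2_apply, add_mul, one_mul, add_right_inj]

theorem finiteDimensional_iSup_eigenspace (hΩo : IsOpen Ω) (hΩ : Bornology.IsBounded Ω) (Λ : ℝ) :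
    FiniteDimensional ℝ (⨆ μ : Set.Iic Λ, eigenspace Ω (μ : ℝ) : Submodule ℝ (H10 Ω)) :=
  finiteDimensional_iSup_eigenspaces (E := H10 Ω) (L := Lp ℝ 2 (volume.restrict Ω))
    (isCompactOperator_embedL2 hΩo hΩ) mem_eigenspace_iff_inner Λ

theorem natCast_le_rank_iff (hΩo : IsOpen Ω) (hΩ : Bornology.IsBounded Ω) (Λ : ℝ) (k : ℕ) :
    (k : Cardinal) ≤
      Module.rank ℝ (⨆ μ : Set.Iic Λ, eigenspace Ω (μ : ℝ) : Submodule ℝ (H10 Ω)) ↔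
      k ≤ finrank ℝ (⨆ μ : Set.Iic Λ, eigenspace Ω (μ : ℝ) : Submodule ℝ (H10 Ω)) := by
  have := finiteDimensional_iSup_eigenspace hΩo hΩ Λ
  rw [← finrank_eq_rank, Nat.cast_le]

/-- On this span `‖∇u‖² ≤ Λ ‖u‖²` in `L²`. It follows that the set defining `λ_k` is bounded below
by `0` when `k ≥ 1`. -/
theorem iSup_eigenspace_eq_bot {Λ : ℝ} (hΛ : Λ < 0) :
    (⨆ μ : Set.Iic Λ, eigenspace Ω (μ : ℝ) : Submodule ℝ (H10 Ω)) = ⊥ := by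
  rw [Submodule.eq_bot_iff]
  intro u hu
  have h1 : ‖u‖ ^ 2 ≤ (1 + Λ) * ‖embedL2 Ω u‖ ^ 2 :=
    norm_sq_le_of_mem_iSup (E := H10 Ω) (L := Lp ℝ 2 (volume.restrict Ω))
      mem_eigenspace_iff_inner hu
  rw [embedL2_apply] at h1
  have h2 := norm_sq_eq u
  have h3 : ‖u.fn‖ ^ 2 ≤ 0 := by
    by_contra! h
    have := mul_neg_of_neg_of_pos hΛ h
    linarith [sq_nonneg ‖u.grad‖]
  have h4 : ‖u‖ ^ 2 ≤ 0 := by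
    have : ‖u.fn‖ ^ 2 = 0 := le_antisymm h3 (sq_nonneg _)
    rw [this] at h1
    linarith
  exact norm_eq_zero.1 (pow_eq_zero_iff two_ne_zero |>.1 (le_antisymm h4 (sq_nonneg _)))

theorem nonneg_of_natCast_le_rank {k : ℕ} (hk : 1 ≤ k) {Λ : ℝ} (h : (k : Cardinal) ≤
    Module.rank ℝ (⨆ μ : Set.Iic Λ, eigenspace Ω (μ : ℝ) : Submodule ℝ (H10 Ω))) : 0 ≤ Λ := by
  by_contra! hΛ
  rw [iSup_eigenspace_eq_bot hΛ, rank_bot, nonpos_iff_eq_zero, Nat.cast_eq_zero] at h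
  omega

theorem dirichletEigenvalue_nonneg {k : ℕ} (hk : 1 ≤ k) : 0 ≤ dirichletEigenvalue Ω k :=
  Real.sInf_nonneg fun _ h => nonneg_of_natCast_le_rank hk h

/-- The Courant–Fischer lower bound: `n - 1` linear constraints suffice to raise the Rayleigh
quotient above any level below the `n`-th eigenvalue. -/
theorem exists_constraints (hΩo : IsOpen Ω) (hΩ : Bornology.IsBounded Ω) {n : ℕ} (hn : 1 ≤ n)
    {Λ : ℝ} (hΛ : Λ < dirichletEigenvalue Ω n) :
    ∃ b : ℕ → H10 Ω, ∀ u : H10 Ω, (∀ j < n - 1, inner ℝ (b j) u = 0) →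
      Λ * ‖u.fn‖ ^ 2 ≤ ‖u.grad‖ ^ 2 := by
  rcases lt_or_ge Λ 0 with hneg | hpos
  · refine ⟨0, fun u _ => ?_⟩
    have := mul_nonneg (neg_nonneg.2 hneg.le) (sq_nonneg ‖u.fn‖)
    linarith [sq_nonneg ‖u.grad‖]
  set W : Submodule ℝ (H10 Ω) := ⨆ μ : Set.Iic Λ, eigenspace Ω (μ : ℝ) with hW
  have hfin : FiniteDimensional ℝ W := finiteDimensional_iSup_eigenspace hΩo hΩ Λ
  have hrank : finrank ℝ W < n := by
    by_contra! h
    exact hΛ.not_ge (csInf_le ⟨0, fun _ h => nonneg_of_natCast_le_rank hn h⟩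
      ((natCast_le_rank_iff hΩo hΩ Λ n).2 h))
  let e := finBasis ℝ W
  -- A basis of `W` has at most `n - 1` elements; the sequence is padded with zeros.
  refine ⟨fun j => if h : j < finrank ℝ W then (e ⟨j, h⟩ : H10 Ω) else 0, fun u hu => ?_⟩
  have hmem : u ∈ Wᗮ := by
    intro w hw
    have h1 : w = ((∑ j, e.repr ⟨w, hw⟩ j • e j : W) : H10 Ω) := by rw [e.sum_repr]
    rw [h1, Submodule.coe_sum, sum_inner]
    refine Finset.sum_eq_zero fun j _ => ?_
    have h2 := hu j (by omega)
    simp only [j.2, dif_pos, Fin.eta] at h2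
    rw [Submodule.coe_smul, real_inner_smul_left, h2, mul_zero]
  have h1 : (1 + Λ) * ‖embedL2 Ω u‖ ^ 2 ≤ ‖u‖ ^ 2 :=
    norm_sq_ge_of_mem_orthogonal (E := H10 Ω) (L := Lp ℝ 2 (volume.restrict Ω))
      (isCompactOperator_embedL2 hΩo hΩ) mem_eigenspace_iff_inner hpos hmem
  rw [embedL2_apply, norm_sq_eq] at h1
  linarith

theorem tendsto_dirichletEigenvalue (hN : 0 < N) (hΩo : IsOpen Ω) (hΩ : Bornology.IsBounded Ω)
    (hne : Ω.Nonempty) : Tendsto (fun k : ℕ => dirichletEigenvalue Ω k) atTop atTop := by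
  rw [tendsto_atTop]
  intro R
  filter_upwards [eventually_gt_atTop
    (finrank ℝ (⨆ μ : Set.Iic R, eigenspace Ω (μ : ℝ) : Submodule ℝ (H10 Ω)))] with k hk
  refine le_csInf ?_ fun Λ hΛ => ?_
  -- Nonemptiness matters: the real infimum of the empty set is `0`.
  · obtain ⟨Λ, hΛ⟩ := exists_le_finrank_iSup_eigenspaces (E := H10 Ω)
      (L := Lp ℝ 2 (volume.restrict Ω)) (isCompactOperator_embedL2 hΩo hΩ)
      mem_eigenspace_iff_inner (not_finiteDimensional_range_embedL2 hN hΩo hne) k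
    exact ⟨Λ, (natCast_le_rank_iff hΩo hΩ Λ k).2 hΛ⟩
  · by_contra! hlt
    have h1 := (natCast_le_rank_iff hΩo hΩ Λ k).1 hΛ
    have h2 : (⨆ μ : Set.Iic Λ, eigenspace Ω (μ : ℝ) : Submodule ℝ (H10 Ω)) ≤
        ⨆ μ : Set.Iic R, eigenspace Ω (μ : ℝ) := iSup_le fun μ =>
      le_iSup (fun ν : Set.Iic R => eigenspace Ω (ν : ℝ)) ⟨μ, le_trans μ.2 hlt.le⟩
    have := finiteDimensional_iSup_eigenspace hΩo hΩ R
    exact (h1.trans (Submodule.finrank_mono h2)).not_gt hk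

end Eigenvalues

/-! ### Positive and negative parts; sign of the primitives. -/

section Signs

variable {α : Type*} [MeasurableSpace α] {μ : Measure α}

theorem norm_sq_posPart_add_norm_sq_negPart (f : Lp ℝ 2 μ) : ‖f⁺‖ ^ 2 + ‖f⁻‖ ^ 2 = ‖f‖ ^ 2 := by
  have h1 : inner ℝ f⁺ f⁻ = (0 : ℝ) := by
    rw [L2.inner_def]
    refine integral_eq_zero_of_ae ?_
    filter_upwards [Lp.coeFn_sup f 0, Lp.coeFn_sup (-f) 0, Lp.coeFn_neg f,
      Lp.coeFn_zero ℝ 2 μ] with x e1 e2 e3 e4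
    rw [posPart_def, negPart_def, e1, e2, Pi.sup_apply, Pi.sup_apply, e3, e4, Pi.neg_apply]
    rcases le_total (f x) 0 with h | h
    · simp [h]
    · simp [h]
  have h2 : ‖f⁺ - f⁻‖ ^ 2 = ‖f⁺‖ ^ 2 - 2 * inner ℝ f⁺ f⁻ + ‖f⁻‖ ^ 2 := norm_sub_sq_real _ _
  rw [posPart_sub_negPart, h1] at h2
  linarith

/-- Pointwise `f⁻ ≤ |f - v|` when `v ≥ 0`. -/
theorem norm_negPart_le_norm_sub (f : Lp ℝ 2 μ) {v : Lp ℝ 2 μ} (hv : 0 ≤ v) :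
    ‖f⁻‖ ≤ ‖f - v‖ := by
  refine norm_le_norm_of_abs_le_abs ?_
  rw [abs_of_nonneg (negPart_nonneg f), negPart_def]
  refine sup_le ?_ (abs_nonneg _)
  refine le_trans ?_ (neg_le_abs (f - v))
  rw [neg_sub, ← sub_nonneg]
  simpa using hv

theorem norm_posPart_le_norm_sub (f : Lp ℝ 2 μ) {v : Lp ℝ 2 μ} (hv : v ≤ 0) :
    ‖f⁺‖ ≤ ‖f - v‖ := by
  have h := norm_negPart_le_norm_sub (-f) (neg_nonneg.2 hv)
  rwa [negPart_neg, neg_sub_neg, norm_sub_rev] at h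

/-- Oddness gives `h 0 = 0`, so `h ≥ 0` on `[0, ∞)`; the primitive of an odd function is even. -/
theorem primitive_nonneg {h : ℝ → ℝ} (hd : ContDiff ℝ 1 h) (hodd : ∀ t, h (-t) = -h t)
    (hderiv : ∀ t, 0 < t → 0 ≤ deriv h t) (s : ℝ) : 0 ≤ primitive h s := by
  have h0 : h 0 = 0 := by
    have := hodd 0
    rw [neg_zero] at this
    linarith
  have hmono : MonotoneOn h (Set.Ici 0) :=
    monotoneOn_of_deriv_nonneg (convex_Ici 0) hd.continuous.continuousOn
      (hd.differentiable one_ne_zero).differentiableOn fun x hx => hderiv x (by simpa using hx)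
  have hpos : ∀ t, 0 ≤ t → 0 ≤ h t := fun t ht =>
    h0 ▸ hmono (Set.mem_Ici.2 le_rfl) (Set.mem_Ici.2 ht) ht
  have hmain : ∀ s, 0 ≤ s → 0 ≤ primitive h s := fun s hs =>
    intervalIntegral.integral_nonneg hs fun t ht => hpos t ht.1
  rcases le_total 0 s with hs | hs
  · exact hmain s hs
  · have h1 : primitive h (-s) = primitive h s := by
      unfold primitive
      have h2 := intervalIntegral.integral_comp_neg (a := 0) (b := s) h
      rw [neg_zero, intervalIntegral.integral_symm 0 (-s)] at h2
      simp only [hodd, intervalIntegral.integral_neg] at h2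
      linarith
    rw [← h1]
    exact hmain _ (by linarith)

end Signs

/-! ### Lower bound for the minimax levels. -/

section Levels

variable {N m : ℕ} {Ω : Set (Eu N)}

/-- All other terms of the energy are integrals of nonnegative functions, and these are nonnegative
whether or not the integrand is integrable. -/
theorem sum_norm_grad_sq_le_energy {f g : ℝ → ℝ} (hfg : Admissible N f g) (u : Fin m → H10 Ω) :
    ∑ i, ‖(u i).grad‖ ^ 2 ≤ energy Ω f g u := by
  have hF := primitive_nonneg hfg.contDiff_f hfg.odd_f fun t ht => (hfg.deriv_nonneg t ht).1
  have hG := primitive_nonneg hfg.contDiff_g hfg.odd_g fun t ht => (hfg.deriv_nonneg t ht).2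
  unfold energy
  have h1 : 0 ≤ ∑ i, ∑ j ∈ Finset.univ.filter (fun j => j ≠ i),
      ∫ x in Ω, primitive f ((u i).fn x) * primitive f ((u j).fn x) :=
    Finset.sum_nonneg fun i _ => Finset.sum_nonneg fun j _ =>
      integral_nonneg fun x => mul_nonneg (hF _) (hF _)
  refine le_add_of_le_of_nonneg (Finset.sum_le_sum fun i _ => ?_) h1
  refine le_add_of_le_of_nonneg (le_of_eq ?_)
    (integral_nonneg fun x => mul_nonneg zero_le_two (hG _))
  rw [← real_inner_self_eq_norm_sq, L2.inner_def]
  simp only [real_inner_self_eq_norm_sq]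

/-- The odd map on `H¹₀(Ω)` whose zeros have positive and negative parts of equal `L²`-norm and are
orthogonal to `b 0, …, b (d - 2)`. -/
noncomputable def balancedMap (d : ℕ) (b : ℕ → H10 Ω) (u : H10 Ω) : EuclideanSpace ℝ (Fin d) :=
  WithLp.toLp 2 fun j => if (j : ℕ) = 0 then ‖u.fn⁺‖ - ‖u.fn⁻‖ else inner ℝ (b (j - 1)) u

theorem continuous_fn : Continuous fun u : H10 Ω => u.fn := (embedL2 Ω).continuous

theorem continuous_balancedMap (d : ℕ) (b : ℕ → H10 Ω) : Continuous (balancedMap d b) := by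
  refine (PiLp.continuous_toLp 2 _).comp (continuous_pi fun j => ?_)
  split_ifs
  · exact (continuous_posPart.comp continuous_fn).norm.sub
      (continuous_negPart.comp continuous_fn).norm
  · exact continuous_const.inner continuous_id

theorem fn_neg (u : H10 Ω) : (-u).fn = -u.fn := rfl

theorem balancedMap_neg (d : ℕ) (b : ℕ → H10 Ω) (u : H10 Ω) :
    balancedMap d b (-u) = -balancedMap d b u := by
  ext j
  simp only [balancedMap, PiLp.neg_apply, fn_neg, posPart_neg, negPart_neg]
  split_ifs
  · ring
  · rw [inner_neg_right]

theorem isEquivariantFamily_balancedMap (k : Fin m → ℕ) (A : Set (Fin m → H10 Ω))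
    (b : Fin m → ℕ → H10 Ω) :
    IsEquivariantFamily k A fun i u => balancedMap (k i - 1) (b i) (u i) := by
  intro i
  refine ⟨((continuous_balancedMap _ _).comp (continuous_apply i)).continuousOn,
    fun u _ => ⟨?_, fun j hj => ?_⟩⟩
  · simp only [signFlip, Function.update_self, balancedMap_neg]
  · simp only [signFlip, Function.update_of_ne hj.symm]

/-- A function with unit norm and balanced positive and negative parts stays away from the cone of
signed functions. -/
theorem notMem_coneNhd {u : Fin m → H10 Ω} (hu : u ∈ sphereM Ω m)
    (hbal : ∀ i, ‖(u i).fn⁺‖ = ‖(u i).fn⁻‖) {δ : ℝ} (hδ : δ < Real.sqrt 2 / 2) :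
    u ∉ coneNhd Ω m δ := by
  rintro ⟨v, ⟨i, hi⟩, hv⟩
  have h1 := norm_sq_posPart_add_norm_sq_negPart (u i).fn
  rw [hu i, hbal i] at h1
  have h2 : ‖(u i).fn⁻‖ = Real.sqrt 2 / 2 := by
    have h3 : ‖(u i).fn⁻‖ ^ 2 = (Real.sqrt 2 / 2) ^ 2 := by
      rw [div_pow, Real.sq_sqrt zero_le_two]
      linarith
    exact (pow_left_inj₀ (norm_nonneg _) (by positivity) two_ne_zero).1 h3
  have h3 : ‖(u i).fn⁻‖ ≤ ‖(u i).fn - (v i).fn‖ := by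
    rcases hi with hi | hi
    · exact norm_negPart_le_norm_sub _ hi
    · rw [← hbal i]
      exact norm_posPart_le_norm_sub _ hi
  have h4 : ‖(u i).fn - (v i).fn‖ ≤ dist2 u v :=
    Real.le_sqrt_of_sq_le (Finset.single_le_sum
      (f := fun j => ‖(u j).fn - (v j).fn‖ ^ 2) (fun j _ => sq_nonneg _) (Finset.mem_univ i))
  linarith

theorem sum_le_minimaxLevel (hΩo : IsOpen Ω) (hΩ : Bornology.IsBounded Ω) {f g : ℝ → ℝ}
    (hfg : Admissible N f g) {k : Fin m → ℕ} (hk : ∀ i, 2 ≤ k i) {δ : ℝ}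
    (hδ : δ < Real.sqrt 2 / 2) {Λ : Fin m → ℝ}
    (hΛ : ∀ i, Λ i < dirichletEigenvalue Ω (k i - 1)) :
    ((∑ i, Λ i : ℝ) : EReal) ≤ minimaxLevel Ω f g δ k := by
  -- With `n = k i - 1` there are `k i - 2` constraints; the balance condition is one more, filling
  -- exactly the `k i - 1` coordinates of `h i`.
  choose b hb using fun i =>
    exists_constraints hΩo hΩ (show 1 ≤ k i - 1 by have := hk i; omega) (hΛ i)
  refine le_iInf₂ fun A hA => ?_
  obtain ⟨u, huA, hu0⟩ := hA.2 _ (isEquivariantFamily_balancedMap k A b)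
  have huM : u ∈ sphereM Ω m := hA.1.1 huA
  have hcoord : ∀ i (j : ℕ) (hj : j < k i - 1),
      (if j = 0 then ‖(u i).fn⁺‖ - ‖(u i).fn⁻‖ else inner ℝ (b i (j - 1)) (u i)) = 0 :=
    fun i j hj => congrArg (fun w : EuclideanSpace ℝ (Fin (k i - 1)) => w ⟨j, hj⟩) (hu0 i)
  have hbal : ∀ i, ‖(u i).fn⁺‖ = ‖(u i).fn⁻‖ := fun i =>
    sub_eq_zero.1 (by simpa using hcoord i 0 (by have := hk i; omega))
  refine le_iSup₂_of_le u ⟨huA, notMem_coneNhd huM hbal hδ⟩ ?_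
  rw [EReal.coe_le_coe_iff]
  refine le_trans (Finset.sum_le_sum fun i _ => ?_) (sum_norm_grad_sq_le_energy hfg u)
  have h1 := hb i (u i) fun j hj => by simpa using hcoord i (j + 1) (by omega)
  rwa [huM i, one_pow, mul_one] at h1

/-- Take `Λ i = λ_{k_i - 1} - ε` and let `ε` decrease to `0`. -/
theorem sum_dirichletEigenvalue_le_minimaxLevel (hΩo : IsOpen Ω) (hΩ : Bornology.IsBounded Ω)
    {f g : ℝ → ℝ} (hfg : Admissible N f g) {k : Fin m → ℕ} (hk : ∀ i, 2 ≤ k i) {δ : ℝ}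
    (hδ : δ < Real.sqrt 2 / 2) :
    ((∑ i, dirichletEigenvalue Ω (k i - 1) : ℝ) : EReal) ≤ minimaxLevel Ω f g δ k := by
  have hlim : Tendsto (fun ε : ℝ => ((∑ i, (dirichletEigenvalue Ω (k i - 1) - ε) : ℝ) : EReal))
      (𝓝[>] 0) (𝓝 ((∑ i, (dirichletEigenvalue Ω (k i - 1) - 0) : ℝ) : EReal)) := by
    have h1 : Continuous fun ε : ℝ =>
        ((∑ i, (dirichletEigenvalue Ω (k i - 1) - ε) : ℝ) : EReal) :=
      continuous_coe_real_ereal.comp (by fun_prop)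
    exact (h1.tendsto 0).mono_left nhdsWithin_le_nhds
  simp only [sub_zero] at hlim
  refine le_of_tendsto hlim ?_
  filter_upwards [self_mem_nhdsWithin] with ε hε
  exact sum_le_minimaxLevel hΩo hΩ hfg hk hδ fun i => sub_lt_self _ hε

end Levels

end CompetingSystem

theorem lemma2p12 {N m : ℕ} (hN : 2 ≤ N) (Ω : Set (CompetingSystem.Eu N))
    (hΩ_open : IsOpen Ω) (hΩ_bdd : Bornology.IsBounded Ω) (hΩ_ne : Ω.Nonempty)
    (f g : ℝ → ℝ) (hfg : CompetingSystem.Admissible N f g) :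
    -- the lower bound
    (∀ k : Fin m → ℕ, (∀ i, 2 ≤ k i) → ∀ δ : ℝ, 0 < δ → δ < Real.sqrt 2 / 2 →
      ((∑ i, CompetingSystem.dirichletEigenvalue Ω (k i - 1) : ℝ) : EReal) ≤
        CompetingSystem.minimaxLevel Ω f g δ k) ∧
    -- the eigenvalues tend to infinity
    Tendsto (fun k : ℕ => CompetingSystem.dirichletEigenvalue Ω k) atTop atTop ∧
    -- the levels tend to infinity as some `k i` does, uniformly in `δ`
    (∀ R : ℝ, ∃ K : ℕ, ∀ k : Fin m → ℕ, (∀ i, 2 ≤ k i) → (∃ i, K ≤ k i) →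
      ∀ δ : ℝ, 0 < δ → δ < Real.sqrt 2 / 2 →
        (R : EReal) ≤ CompetingSystem.minimaxLevel Ω f g δ k) := by
  have hlim := CompetingSystem.tendsto_dirichletEigenvalue (by omega) hΩ_open hΩ_bdd hΩ_ne
  refine ⟨fun k hk δ _ hδ =>
    CompetingSystem.sum_dirichletEigenvalue_le_minimaxLevel hΩ_open hΩ_bdd hfg hk hδ, hlim,
    fun R => ?_⟩
  obtain ⟨K, hK⟩ := eventually_atTop.1 (tendsto_atTop.1 hlim R)
  -- The shift by one accounts for the index `k i - 1`; the other eigenvalues are nonnegative and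
  -- can be dropped.
  refine ⟨K + 1, fun k hk ⟨i, hi⟩ δ _ hδ => ?_⟩
  refine le_trans (EReal.coe_le_coe_iff.2 ?_)
    (CompetingSystem.sum_dirichletEigenvalue_le_minimaxLevel hΩ_open hΩ_bdd hfg hk hδ)
  refine (hK (k i - 1) (by omega)).trans (Finset.single_le_sum
    (f := fun j => CompetingSystem.dirichletEigenvalue Ω (k j - 1)) (fun j _ => ?_)
    (Finset.mem_univ i))
  exact CompetingSystem.dirichletEigenvalue_nonneg (by have := hk j; omega)
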